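/- \textbf{Theorem (Chaining).} Let $G_o\in\mathbb{R}$ and let $A,B,W,\alpha,q,Q>0$. There is a constant $C>0$, depending only on $G_o,A,B,W,\alpha,q,Q$, such that the following holds. Let $(Y_n)_{n\in\mathbb{N}}$ be random variables on a probability space $(\Omega,\mathcal{F},\mathbb{P})$, with $Y_n$ taking values in a Polish space $\mathcal{Y}_n$, and let $\mathbb{P}(\,\cdot\,|Y_n=y)$ be a regular conditional probability on $\Omega$ given $Y_n$. For every $y\in\mathcal{Y}_n$ let $(Z_n(t;y))_{t\in\mathcal{T}_{y}}$ be a real stochastic process indexed by a countable metric space $(\mathcal{T}_{y},\rho_n(\cdot,\cdot;y))$ (depending on $n$ and $y$) with $\rho_n\le 1$. Conditional probabilities of events about $Z_n(\cdot;Y_n)$ are taken under the conditional law of $Z_n(\cdot;Y_n)$ given $Y_n=y$, i.e. the law of $Z_n(\cdot;y)$ under $\mathbb{P}(\,\cdot\,|Y_n=y)$. Assume: \textbf{(i)} There are functions $\sigma_n(\cdot;y):\mathcal{T}_y\to(0,1]$, measurable functions $G_n(\cdot,\delta):[0,\infty)\to[0,\infty)$ ($\delta>0$) with $G_n(\eta,\delta)\le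 G_o(1+\eta)$ for all $n$, $\eta\ge0$, $0<\delta\le1$, and a constant $L<\infty$, such that for every $n$ and $\mathbb{P}^{Y_n}$-almost every $y$: for all $s,t\in\mathcal{T}_y$, $\eta\ge0$, $\delta>0$, $$\mathbb{P}\big(|Z_n(t;Y_n)|\ge\sigma_n(t;Y_n)\,G_n(\eta,\delta)\,\big|\,Y_n=y\big)\le 2e^{-\eta}\quad\text{if }\sigma_n(t;y)\ge\delta,$$ $$|\sigma_n(t;y)-\sigma_n(s;y)|\le L\,\rho_n(s,t;y),\qquad \{t\in\mathcal{T}_y:\sigma_n(t;y)\ge\delta\}\text{ is compact}.$$ \textbf{(ii)} There are measurable sets $\mathcal{C}_n\subset\mathcal{Y}_n$ such that for every $n$ and $\mathbb{P}^{Y_n}$-almost every $y\in\mathcal{C}_n$, for all $u,\delta\in(0,1]$, $$N\big(u\delta,\{t\in\mathcal{T}_y:\sigma_n(t;y)\le\delta\},\rho_n(\cdot,\cdot;y)\big)\le A\,u^{-B}\delta^{-W}\log\big(e/(u\delta)\big)^{\alpha},$$ where $N(\varepsilon,S,\rho)$ is the minimal number of points of $S$ whose closed $\varepsilon$-balls cover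 $S$. For $\delta>0$ let $\mathcal{A}_n(\delta,q,Q;Y_n)$ be the event that $$\frac{|Z_n(s;Y_n)-Z_n(t;Y_n)|}{\rho_n(s,t;Y_n)\log(e/\rho_n(s,t;Y_n))^q}\le Q\quad\text{for all distinct }s,t\in\mathcal{T}_{Y_n}\text{ with }\rho_n(s,t;Y_n)\le\delta .$$ \textbf{(1)} For every $n$, for $\mathbb{P}^{Y_n}$-almost every $y\in\mathcal{C}_n$ and all $0<\delta\le1$, conditionally on $Y_n=y$ the probability that $$\frac{|Z_n(t;Y_n)|}{\sigma_n(t;Y_n)}\le G_n\Big(W\log\tfrac{1}{\sigma_n(t;Y_n)}+C\log\log\tfrac{e}{\sigma_n(t;Y_n)},\ \sigma_n(t;Y_n)\Big)+C\Big(\log\tfrac{e}{\sigma_n(t;Y_n)}\Big)^{-1}$$ for all $t\in\mathcal{T}_{Y_n}$ with $\sigma_n(t;Y_n)\le\delta$ is at least $$\mathbb{P}\big(\mathcal{A}_n(2\delta,q,Q;Y_n)\,\big|\,Y_n=y\big)-C\log(e/\delta)^{-1}.$$ \textbf{(2)} Suppose in addition that each $\mathcal{A}_n(\delta,q,Q;Y_n)$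 is measurable (up to null sets) and each $\sup_{t}\sigma_n(t;Y_n)$ is a random variable, that $\mathbb{P}(Y_n\in\mathcal{C}_n)\to1$, that $\lim_{\delta\searrow0}\inf_n\mathbb{P}(\mathcal{A}_n(\delta,q,Q;Y_n)|Y_n)=1$ a.s., and that $\inf_n\sup_{t\in\mathcal{T}_{Y_n}}\sigma_n(t;Y_n)>0$ a.s. Let $\Lambda_n$ be the conditional law given $Y_n$ of the $[-\infty,\infty]$-valued variable $$\sup_{t\in\mathcal{T}_{Y_n}}\Big\{\frac{|Z_n(t;Y_n)|}{\sigma_n(t;Y_n)}-G_n\Big(W\log\tfrac{1}{\sigma_n(t;Y_n)}+C\log\log\tfrac{e}{\sigma_n(t;Y_n)},\ \sigma_n(t;Y_n)\Big)\Big\}.$$ Then $(\Lambda_n)$ is tight in probability: for all $\varepsilon,\eta>0$ there is a compact $K\subset\mathbb{R}$ with $\limsup_{n\to\infty}\mathbb{P}^*\big(\Lambda_n(K^c)>\varepsilon\big)\le\eta$, where $\mathbb{P}^*$ is outer probability. -/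

import Mathlib

open MeasureTheory ProbabilityTheory Filter Topology
open scoped ENNReal NNReal

noncomputable section

/-- `log (e / x)`. -/
def logE (x : ℝ) : ℝ := Real.log (Real.exp 1 / x)

/-- The pointwise condition (i) for a process `X` on a metric space `T` under a probability
measure `ν` (a conditional distribution): `σ` takes values in `(0, 1]`, the standardised tails are
bounded through `G`, `σ` is Lipschitz with constant `L`, and its superlevel sets are compact. -/
structure ScaleCondition {T Ω : Type*} [MetricSpace T] [MeasurableSpace Ω]
    (ν : Measure Ω) (X : T → Ω → ℝ) (σ : T → ℝ) (G : ℝ → ℝ → ℝ) (L : ℝ) : Prop where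
  pos : ∀ t, 0 < σ t
  le_one : ∀ t, σ t ≤ 1
  tail : ∀ (t : T) (η δ : ℝ), 0 ≤ η → 0 < δ → δ ≤ σ t →
    ν {ω | σ t * G η δ ≤ |X t ω|} ≤ ENNReal.ofReal (2 * Real.exp (-η))
  lipschitz : ∀ s t : T, |σ t - σ s| ≤ L * dist s t
  compact : ∀ δ : ℝ, 0 < δ → IsCompact {t : T | δ ≤ σ t}

/-- Local covering bound: for all `u, δ ∈ (0, 1]`,
`N(u δ, {σ ≤ δ}, ρ) ≤ A u⁻ᴮ δ⁻ᵂ log(e/(u δ))^α`. -/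
def LocalCoveringBound {T : Type*} [MetricSpace T] (σ : T → ℝ) (A B W α : ℝ) : Prop :=
  ∀ u δ : ℝ, 0 < u → u ≤ 1 → 0 < δ → δ ≤ 1 →
    ((Metric.coveringNumber (u * δ).toNNReal {t : T | σ t ≤ δ} : ℕ∞) : ℝ≥0∞) ≤
      ENNReal.ofReal (A * u ^ (-B) * δ ^ (-W) * logE (u * δ) ^ α)

/-- The event that `|X s - X t| / (ρ(s,t) log(e/ρ(s,t))^q) ≤ Q` for all distinct `s, t` with
`ρ(s,t) ≤ δ`. -/
def modulusEvent {T Ω : Type*} [MetricSpace T] (X : T → Ω → ℝ) (δ q Q : ℝ) : Set Ω :=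
  {ω | ∀ s t : T, s ≠ t → dist s t ≤ δ →
    |X s ω - X t ω| / (dist s t * logE (dist s t) ^ q) ≤ Q}

/-- The additive correction `G(W log(1/s) + C log log(e/s), s)`. -/
def correction (G : ℝ → ℝ → ℝ) (W C s : ℝ) : ℝ :=
  G (W * Real.log (1 / s) + C * Real.log (logE s)) s

/-- The event that `|X t| / σ t ≤ G(W log(1/σ t) + C log log(e/σ t), σ t) + C / log(e/σ t)` for all
`t` with `σ t ≤ δ`. -/
def smallScaleEvent {T Ω : Type*} (X : T → Ω → ℝ) (σ : T → ℝ) (G : ℝ → ℝ → ℝ) (W C δ : ℝ) :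
    Set Ω :=
  {ω | ∀ t : T, σ t ≤ δ → |X t ω| / σ t ≤ correction G W C (σ t) + C * (logE (σ t))⁻¹}

/-- The penalised supremum `sup_t {|X t| / σ t - G(W log(1/σ t) + C log log(e/σ t), σ t)}`, formed
in the extended reals. -/
def penalizedSup {T Ω : Type*} (X : T → Ω → ℝ) (σ : T → ℝ) (G : ℝ → ℝ → ℝ) (W C : ℝ)
    (ω : Ω) : EReal :=
  ⨆ t : T, ((|X t ω| / σ t - correction G W C (σ t) : ℝ) : EReal)

/-- A sequence of random measures `Λ n` on the extended reals is (asymptotically) tight in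
`μ`-probability: for all `ε, η > 0` there is a compact `K ⊆ ℝ` with
`limsup_n μ (Λ n (Kᶜ) > ε) ≤ η`. For random probability measures on `ℝ`, each single member of the
sequence is automatically tight, so this is the same as the supremum over `n`. -/
def TightInProbability {Ω : Type*} [MeasurableSpace Ω] (μ : Measure Ω)
    (Λ : ℕ → Ω → Measure EReal) : Prop :=
  ∀ ε η : ℝ≥0∞, 0 < ε → 0 < η → ∃ K : Set ℝ, IsCompact K ∧
    limsup (fun n => μ {ω | ε < Λ n ω (((↑) : ℝ → EReal) '' K)ᶜ}) atTop ≤ η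

end

/-! Small scales are cut into dyadic bands `δ/2 < σ ≤ δ`. Write `l = logE δ` and cover `{σ ≤ δ}` at
radius `r = l^(-(q+1)) δ`. On the modulus event `X` varies over a cell by a multiple of `r
logE(r)^q`, hence by `O(δ / l)`, and division by `σ > δ/2` leaves the error `O(1 / logE σ)`.

No regularity of `G` is available to compare thresholds inside a cell. Each cell is therefore
represented by one of its own points in the band, chosen to nearly minimise the threshold `σ G(η,
σ)`: an exceedance anywhere in the cell then forces one at the representative
(`exists_finset_near_minimizer`, `ScaleCondition.measure_cells_le`). The tail there is at most `2
δ^W l^(-C)`, which cancels the factor `δ^(-W)` of the covering number. For large `C` the powers of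
`l` leave `O(l^(-2))` per band (`covering_mul_tail_le`). Since `logE` grows linearly in the band
index, these probabilities sum to `O(1 / logE δ)`.

For tightness, the scales `σ > δ` need one cover of the whole index space and a constant exponent,
with `G` bounded through `Go`. A single point of scale bounded away from zero bounds the supremum
from below. Both cutoffs are chosen uniformly in `n`, outside events of small probability. -/

/-! ### Logarithms and the modulus of continuity -/

lemma logE_eq {x : ℝ} (hx : 0 < x) : logE x = 1 - Real.log x := by
  rw [logE, Real.log_div (Real.exp_pos 1).ne' hx.ne', Real.log_exp]

lemma one_le_logE {x : ℝ} (hx : 0 < x) (hx1 : x ≤ 1) : 1 ≤ logE x := by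
  rw [logE_eq hx]
  linarith [Real.log_nonpos hx.le hx1]

lemma logE_le_logE {x y : ℝ} (hx : 0 < x) (hxy : x ≤ y) : logE y ≤ logE x := by
  rw [logE_eq hx, logE_eq (hx.trans_le hxy)]
  linarith [Real.log_le_log hx hxy]

lemma logE_half {x : ℝ} (hx : 0 < x) : logE (x / 2) = logE x + Real.log 2 := by
  rw [logE_eq hx, logE_eq (by positivity), Real.log_div hx.ne' two_ne_zero]
  ring

/-- Follows from `log r ≤ q r^(1/q)` and `1 ≤ r^(1/q)`, raised to the power `q`. -/
lemma one_add_log_rpow_le {r q : ℝ} (hr : 1 ≤ r) (hq : 0 < q) :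
    (1 + Real.log r) ^ q ≤ (1 + q) ^ q * r := by
  have hr0 : 0 ≤ r := zero_le_one.trans hr
  have h1 : Real.log r ≤ q * r ^ q⁻¹ := by
    have := Real.log_le_rpow_div hr0 (inv_pos.2 hq)
    rwa [div_inv_eq_mul, mul_comm] at this
  have h2 : (1 : ℝ) ≤ r ^ q⁻¹ := Real.one_le_rpow hr (inv_pos.2 hq).le
  have h3 : 1 + Real.log r ≤ (1 + q) * r ^ q⁻¹ := by linarith
  calc (1 + Real.log r) ^ q ≤ ((1 + q) * r ^ q⁻¹) ^ q :=
        Real.rpow_le_rpow (by linarith [Real.log_nonneg hr]) h3 hq.le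
    _ = (1 + q) ^ q * r := by
        rw [Real.mul_rpow (by linarith) (by positivity), ← Real.rpow_mul hr0,
          inv_mul_cancel₀ hq.ne', Real.rpow_one]

/-- The modulus `d ↦ d log(e/d)^q` is increasing up to a constant. -/
lemma mul_logE_rpow_le {d x q : ℝ} (hd : 0 < d) (hd1 : d ≤ 1) (hx : 0 < x) (hx1 : x ≤ 1)
    (hdx : d ≤ 2 * x) (hq : 0 < q) :
    d * logE d ^ q ≤ 2 * (1 + q) ^ q * x * logE x ^ q := by
  have hc : (1 : ℝ) ≤ (1 + q) ^ q := Real.one_le_rpow (by linarith) hq.le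
  have hlx := one_le_logE hx hx1
  have hld := one_le_logE hd hd1
  have hlq : 0 ≤ logE x ^ q := Real.rpow_nonneg (by linarith) q
  rcases le_total d x with h | h
  · have hr : 1 ≤ x / d := (one_le_div hd).2 h
    have hlog := Real.log_nonneg hr
    -- Since `logE x ≥ 1`, the sum `logE x + log (x / d)` is at most a product; the second factor is
    -- then paid for by `x / d`.
    have h1 : logE d ≤ logE x * (1 + Real.log (x / d)) := by
      have : logE d = logE x + Real.log (x / d) := by
        rw [logE_eq hd, logE_eq hx, Real.log_div hx.ne' hd.ne']; ring
      nlinarith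
    calc d * logE d ^ q ≤ d * (logE x * (1 + Real.log (x / d))) ^ q := by gcongr
      _ = d * (logE x ^ q * (1 + Real.log (x / d)) ^ q) := by
          rw [Real.mul_rpow (by linarith) (by linarith)]
      _ ≤ d * (logE x ^ q * ((1 + q) ^ q * (x / d))) := by
          gcongr; exact one_add_log_rpow_le hr hq
      _ = (1 + q) ^ q * x * logE x ^ q := by field_simp
      _ ≤ 2 * (1 + q) ^ q * x * logE x ^ q := by
          have : 0 ≤ (1 + q) ^ q * x * logE x ^ q := by positivity
          linarith
  · calc d * logE d ^ q ≤ (2 * x) * logE x ^ q := by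
          gcongr
          exact logE_le_logE hx h
      _ = (2 * 1 * x) * logE x ^ q := by ring
      _ ≤ 2 * (1 + q) ^ q * x * logE x ^ q := by gcongr

lemma modulusEvent_anti {T Ω : Type*} [MetricSpace T] (X : T → Ω → ℝ) (q Q : ℝ) :
    Antitone fun δ => modulusEvent X δ q Q :=
  fun _ _ h _ hω s t hst hd => hω s t hst (hd.trans h)

lemma abs_sub_le_of_mem_modulusEvent {T Ω : Type*} [MetricSpace T] {X : T → Ω → ℝ}
    {δ q Q x : ℝ} {ω : Ω} {s t : T} (hω : ω ∈ modulusEvent X δ q Q) (hq : 0 < q) (hQ : 0 < Q)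
    (hx : 0 < x) (hx1 : x ≤ 1) (hd1 : dist s t ≤ 1) (hdx : dist s t ≤ 2 * x) (hxδ : 2 * x ≤ δ) :
    |X s ω - X t ω| ≤ Q * (2 * (1 + q) ^ q * x * logE x ^ q) := by
  have hlx := one_le_logE hx hx1
  by_cases hst : s = t
  · subst hst
    have : 0 ≤ logE x ^ q := Real.rpow_nonneg (by linarith) q
    simp only [sub_self, abs_zero]
    positivity
  · have hd : 0 < dist s t := dist_pos.2 hst
    have hl := one_le_logE hd hd1
    have hlq : 0 < logE (dist s t) ^ q := Real.rpow_pos_of_pos (by linarith) q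
    have h := (div_le_iff₀ (mul_pos hd hlq)).1 (hω s t hst (hdx.trans hxδ))
    exact h.trans (mul_le_mul_of_nonneg_left (mul_logE_rpow_le hd hd1 hx hx1 hdx hq) hQ.le)

/-! ### Union bound over the cells of a cover -/

/-- From a cover of `S` one obtains, for a subset `S'`, as many points of `S'` such that every
point of `S'` is close to one of them at which `h` is not much larger. -/
lemma exists_finset_near_minimizer {T : Type*} [MetricSpace T] {S S' : Set T} (hS : S' ⊆ S)
    {r N ε : ℝ} (hr : 0 < r) (hN0 : 0 ≤ N) (hε : 0 < ε)
    (hN : ((Metric.coveringNumber r.toNNReal S : ℕ∞) : ℝ≥0∞) ≤ ENNReal.ofReal N)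
    (h : T → ℝ) (hh : ∀ t, 0 ≤ h t) :
    ∃ F : Finset T, (F : Set T) ⊆ S' ∧ (F.card : ℝ) ≤ N ∧
      ∀ t ∈ S', ∃ t₀ ∈ F, dist t t₀ ≤ 2 * r ∧ h t₀ ≤ h t + ε := by
  classical
  have hfin : Metric.coveringNumber r.toNNReal S ≠ ⊤ := by
    intro htop
    rw [htop] at hN
    exact absurd hN (by simp)
  obtain ⟨D, -, hDfin, hD, hDcard⟩ := Metric.exists_set_encard_eq_coveringNumber hfin
  have hcard : (hDfin.toFinset.card : ℝ) ≤ N := by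
    rw [← hDcard, hDfin.encard_eq_coe_toFinset_card] at hN
    have := ENNReal.toReal_mono ENNReal.ofReal_ne_top hN
    simpa [ENNReal.toReal_ofReal hN0] using this
  -- The centres may lie outside `S'`, so they are replaced by points of the cells, at the price of
  -- doubling the radius.
  let cell : T → Set T := fun c => S' ∩ Metric.closedBall c r
  have key : ∀ c, (cell c).Nonempty → ∃ t₀ ∈ cell c, ∀ t ∈ cell c, h t₀ ≤ h t + ε := by
    intro c hc
    have hb : BddBelow (h '' cell c) := ⟨0, by rintro _ ⟨t, -, rfl⟩; exact hh t⟩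
    -- The infimum of `h` over a cell need not be attained; the slack `ε` makes a choice possible.
    obtain ⟨_, ⟨t₀, ht₀, rfl⟩, hlt⟩ :=
      exists_lt_of_csInf_lt (hc.image h) (lt_add_of_pos_right (sInf (h '' cell c)) hε)
    exact ⟨t₀, ht₀, fun t ht => hlt.le.trans
      (add_le_add_left (csInf_le hb (Set.mem_image_of_mem h ht)) ε)⟩
  choose! f hf hfmin using key
  refine ⟨(hDfin.toFinset.filter fun c => (cell c).Nonempty).image f, ?_, ?_, ?_⟩
  · intro t ht
    simp only [Finset.coe_image, Finset.coe_filter, Set.mem_image, Set.mem_ofPred_eq] at ht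
    obtain ⟨c, ⟨-, hc⟩, rfl⟩ := ht
    exact (hf c hc).1
  · refine le_trans ?_ hcard
    exact_mod_cast Finset.card_image_le.trans (Finset.card_filter_le _ _)
  · intro t ht
    have := (Metric.isCover_iff_subset_iUnion_closedBall.1 hD) (hS ht)
    simp only [Set.mem_iUnion, Real.coe_toNNReal r hr.le, exists_prop] at this
    obtain ⟨c, hcD, htc⟩ := this
    have hc : (cell c).Nonempty := ⟨t, ht, htc⟩
    refine ⟨f c, ?_, ?_, hfmin c hc t ⟨ht, htc⟩⟩
    · exact Finset.mem_image_of_mem f (by simp [hcD, hc])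
    · have h1 := Metric.mem_closedBall.1 (hf c hc).2
      have h2 := Metric.mem_closedBall.1 htc
      linarith [dist_triangle_right t (f c) c]

/-- Union bound over the cells of a cover. -/
lemma ScaleCondition.measure_cells_le {T Ω : Type*} [MetricSpace T] [MeasurableSpace Ω]
    {ν : Measure Ω} {X : T → Ω → ℝ} {σ : T → ℝ} {G : ℝ → ℝ → ℝ} {L : ℝ}
    (hX : ScaleCondition ν X σ G L) (hG : ∀ η δ, 0 ≤ η → 0 < δ → 0 ≤ G η δ)
    (hdist : ∀ s t : T, dist s t ≤ 1) {S S' : Set T} (hS : S' ⊆ S) {r N ε δ q Q η₀ : ℝ}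
    (hr : 0 < r) (hr1 : r ≤ 1) (hrδ : 2 * r ≤ δ) (hN0 : 0 ≤ N) (hε : 0 < ε) (hq : 0 < q)
    (hQ : 0 < Q)
    (hN : ((Metric.coveringNumber r.toNNReal S : ℕ∞) : ℝ≥0∞) ≤ ENNReal.ofReal N)
    (η : T → ℝ) (hη0 : ∀ t, 0 ≤ η t) (hη : ∀ t ∈ S', η₀ ≤ η t) :
    ν (modulusEvent X δ q Q ∩ {ω | ∃ t ∈ S', σ t * G (η t) (σ t) +
      (ε + Q * (2 * (1 + q) ^ q * r * logE r ^ q)) < |X t ω|}) ≤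
        ENNReal.ofReal (N * (2 * Real.exp (-η₀))) := by
  obtain ⟨F, hFS, hFN, hF⟩ := exists_finset_near_minimizer hS hr hN0 hε hN
    (fun t => σ t * G (η t) (σ t))
    (fun t => mul_nonneg (hX.pos t).le (hG _ _ (hη0 t) (hX.pos t)))
  have hsub : modulusEvent X δ q Q ∩ {ω | ∃ t ∈ S', σ t * G (η t) (σ t) +
      (ε + Q * (2 * (1 + q) ^ q * r * logE r ^ q)) < |X t ω|} ⊆
      ⋃ t ∈ F, {ω | σ t * G (η t) (σ t) ≤ |X t ω|} := by
    rintro ω ⟨hω, t, ht, hlt⟩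
    obtain ⟨t₀, ht₀, hd, hmin⟩ := hF t ht
    simp only [Set.mem_iUnion, Set.mem_ofPred_eq, exists_prop]
    refine ⟨t₀, ht₀, ?_⟩
    have h1 := abs_sub_le_of_mem_modulusEvent hω hq hQ hr hr1 (hdist t t₀) hd hrδ
    have h2 := abs_sub_abs_le_abs_sub (X t ω) (X t₀ ω)
    linarith
  calc _ ≤ ν (⋃ t ∈ F, {ω | σ t * G (η t) (σ t) ≤ |X t ω|}) := measure_mono hsub
    _ ≤ ∑ t ∈ F, ν {ω | σ t * G (η t) (σ t) ≤ |X t ω|} := measure_biUnion_finset_le _ _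
    _ ≤ ∑ t ∈ F, ENNReal.ofReal (2 * Real.exp (-η₀)) := by
        -- The tail bound is used at the level `δ = σ t` itself.
        refine Finset.sum_le_sum fun t ht =>
          (hX.tail t (η t) (σ t) (hη0 t) (hX.pos t) le_rfl).trans ?_
        have := hη t (hFS ht)
        gcongr
    _ = ENNReal.ofReal (F.card * (2 * Real.exp (-η₀))) := by
        rw [Finset.sum_const, nsmul_eq_mul, ENNReal.ofReal_mul (Nat.cast_nonneg _),
          ENNReal.ofReal_natCast]
    _ ≤ _ := by gcongr

/-! ### A single dyadic band -/

/-- Constant in the error term of a single dyadic band of scales. -/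
noncomputable def bandConst (q Q : ℝ) : ℝ := 1 + Q * (2 * (1 + q) ^ q * (q + 2) ^ q)

/-- The constant of the chaining theorem. -/
noncomputable def chainingConst (A B α q Q : ℝ) : ℝ :=
  ((q + 1) * B + α + 2) + 4 * bandConst q Q + 8 * A * (q + 2) ^ α

lemma one_le_bandConst {q Q : ℝ} (hq : 0 < q) (hQ : 0 < Q) : 1 ≤ bandConst q Q := by
  rw [bandConst]
  have : 0 ≤ Q * (2 * (1 + q) ^ q * (q + 2) ^ q) := by positivity
  linarith

/-- The exponent in the correction term. -/
noncomputable def penaltyExponent (W C s : ℝ) : ℝ :=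
  W * Real.log (1 / s) + C * Real.log (logE s)

lemma penaltyExponent_nonneg {W C s : ℝ} (hW : 0 ≤ W) (hC : 0 ≤ C) (hs : 0 < s) (hs1 : s ≤ 1) :
    0 ≤ penaltyExponent W C s :=
  add_nonneg (mul_nonneg hW (Real.log_nonneg ((one_le_div hs).2 hs1)))
    (mul_nonneg hC (Real.log_nonneg (one_le_logE hs hs1)))

lemma penaltyExponent_anti {W C s t : ℝ} (hW : 0 ≤ W) (hC : 0 ≤ C) (hs : 0 < s) (hst : s ≤ t)
    (ht1 : t ≤ 1) : penaltyExponent W C t ≤ penaltyExponent W C s := by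
  have ht := hs.trans_le hst
  have h1 := one_le_logE ht ht1
  have h2 := Real.log_le_log (by linarith) (logE_le_logE hs hst)
  have h3 := Real.log_le_log (by positivity : (0 : ℝ) < 1 / t) (one_div_le_one_div_of_le hs hst)
  exact add_le_add (mul_le_mul_of_nonneg_left h3 hW) (mul_le_mul_of_nonneg_left h2 hC)

lemma exp_neg_penaltyExponent {W C s : ℝ} (hs : 0 < s) (hs1 : s ≤ 1) :
    Real.exp (-penaltyExponent W C s) = s ^ W * logE s ^ (-C) := by
  have h1 := one_le_logE hs hs1
  rw [Real.rpow_def_of_pos hs, Real.rpow_def_of_pos (by linarith), ← Real.exp_add,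
    penaltyExponent, one_div, Real.log_inv]
  ring_nf

/-- With `l = logE δ` the left side equals `l + (q + 1) log l`, and `log l ≤ l - 1`. Refining the
radius by a power of `l` thus costs only a constant factor in the logarithm. -/
lemma logE_band_radius_le {q δ : ℝ} (hq : 0 < q) (hδ : 0 < δ) (hδ1 : δ ≤ 1) :
    logE (logE δ ^ (-(q + 1)) * δ) ≤ (q + 2) * logE δ := by
  have hl := one_le_logE hδ hδ1
  have hl0 : 0 < logE δ := by linarith
  have hu : 0 < logE δ ^ (-(q + 1)) := Real.rpow_pos_of_pos hl0 _
  rw [logE_eq (mul_pos hu hδ), Real.log_mul hu.ne' hδ.ne', Real.log_rpow hl0]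
  have h1 := Real.log_le_sub_one_of_pos hl0
  have h2 := logE_eq hδ
  nlinarith

lemma covering_mul_tail_le {A B W α q C δ : ℝ} (hA : 0 < A) (hα : 0 < α)
    (hq : 0 < q) (hC : (q + 1) * B + α + 2 ≤ C) (hδ : 0 < δ) (hδ1 : δ ≤ 1) :
    A * (logE δ ^ (-(q + 1))) ^ (-B) * δ ^ (-W) * logE (logE δ ^ (-(q + 1)) * δ) ^ α *
      (2 * Real.exp (-penaltyExponent W C δ)) ≤ 2 * A * (q + 2) ^ α * (logE δ ^ 2)⁻¹ := by
  have hl := one_le_logE hδ hδ1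
  have hl0 : 0 < logE δ := by linarith
  have hu : 0 < logE δ ^ (-(q + 1)) := Real.rpow_pos_of_pos hl0 _
  have hu1 : logE δ ^ (-(q + 1)) ≤ 1 := Real.rpow_le_one_of_one_le_of_nonpos hl (by linarith)
  have hlog := logE_band_radius_le hq hδ hδ1
  have hlog1 := one_le_logE (mul_pos hu hδ) (mul_le_one₀ hu1 hδ.le hδ1)
  have hpow : logE (logE δ ^ (-(q + 1)) * δ) ^ α ≤ (q + 2) ^ α * logE δ ^ α := by
    rw [← Real.mul_rpow (by linarith) hl0.le]
    gcongr
  have hδW : δ ^ (-W) * δ ^ W = 1 := by rw [← Real.rpow_add hδ]; simp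
  -- The lower bound on `C` is exactly what leaves the exponent at most `-2`, which is summable over
  -- the bands.
  have hexp : logE δ ^ ((q + 1) * B) * logE δ ^ α * logE δ ^ (-C) ≤ (logE δ ^ 2)⁻¹ := by
    rw [← Real.rpow_add hl0, ← Real.rpow_add hl0, ← Real.rpow_natCast, ← Real.rpow_neg hl0.le]
    apply Real.rpow_le_rpow_of_exponent_le hl
    push_cast
    linarith
  rw [exp_neg_penaltyExponent hδ hδ1, ← Real.rpow_mul hl0.le,
    show -(q + 1) * -B = (q + 1) * B by ring]
  calc _ ≤ A * logE δ ^ ((q + 1) * B) * δ ^ (-W) * ((q + 2) ^ α * logE δ ^ α) *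
        (2 * (δ ^ W * logE δ ^ (-C))) := by gcongr
    _ = 2 * A * (q + 2) ^ α * (δ ^ (-W) * δ ^ W) *
        (logE δ ^ ((q + 1) * B) * logE δ ^ α * logE δ ^ (-C)) := by ring
    _ = 2 * A * (q + 2) ^ α *
        (logE δ ^ ((q + 1) * B) * logE δ ^ α * logE δ ^ (-C)) := by rw [hδW, mul_one]
    _ ≤ _ := by gcongr

lemma band_error_le {q Q δ s : ℝ} (hq : 0 < q) (hQ : 0 < Q) (hδ : 0 < δ) (hδ1 : δ ≤ 1)
    (hs : δ / 2 < s) (hs1 : s ≤ 1) :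
    (δ / logE δ + Q * (2 * (1 + q) ^ q * (logE δ ^ (-(q + 1)) * δ) *
      logE (logE δ ^ (-(q + 1)) * δ) ^ q)) / s ≤ 4 * bandConst q Q * (logE s)⁻¹ := by
  have hl := one_le_logE hδ hδ1
  have hl0 : 0 < logE δ := by linarith
  have hs0 : 0 < s := by linarith
  have hu : 0 < logE δ ^ (-(q + 1)) := Real.rpow_pos_of_pos hl0 _
  have hu1 : logE δ ^ (-(q + 1)) ≤ 1 := Real.rpow_le_one_of_one_le_of_nonpos hl (by linarith)
  have hlog := logE_band_radius_le hq hδ hδ1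
  have hlog1 := one_le_logE (mul_pos hu hδ) (mul_le_one₀ hu1 hδ.le hδ1)
  have hpow : logE (logE δ ^ (-(q + 1)) * δ) ^ q ≤ (q + 2) ^ q * logE δ ^ q := by
    rw [← Real.mul_rpow (by linarith) hl0.le]
    gcongr
  -- Reason for the exponent `q + 1` in the radius: `q` powers absorb the modulus and one is left as
  -- the error.
  have hcancel : logE δ ^ (-(q + 1)) * logE δ ^ q = (logE δ)⁻¹ := by
    rw [← Real.rpow_add hl0, ← Real.rpow_neg_one]
    ring_nf
  have h1 : δ / logE δ + Q * (2 * (1 + q) ^ q * (logE δ ^ (-(q + 1)) * δ) *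
      logE (logE δ ^ (-(q + 1)) * δ) ^ q) ≤ δ * bandConst q Q * (logE δ)⁻¹ :=
    calc _ ≤ δ / logE δ + Q * (2 * (1 + q) ^ q * (logE δ ^ (-(q + 1)) * δ) *
          ((q + 2) ^ q * logE δ ^ q)) := by gcongr
      _ = δ / logE δ + Q * (2 * (1 + q) ^ q * (q + 2) ^ q) * δ *
          (logE δ ^ (-(q + 1)) * logE δ ^ q) := by ring
      _ = δ * bandConst q Q * (logE δ)⁻¹ := by rw [hcancel, bandConst]; ring
  have hD := one_le_bandConst hq hQ
  have hls1 := one_le_logE hs0 hs1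
  have h2 : (logE δ)⁻¹ ≤ 2 * (logE s)⁻¹ := by
    -- Halving the scale adds `log 2 ≤ 1 ≤ logE δ`.
    have h3 : logE s ≤ 2 * logE δ := by
      have h4 := logE_le_logE (half_pos hδ) hs.le
      rw [logE_half hδ] at h4
      linarith [Real.log_two_lt_d9]
    rw [← div_eq_mul_inv, inv_eq_one_div, div_le_div_iff₀ hl0 (by linarith)]
    linarith
  rw [div_le_iff₀ hs0]
  calc _ ≤ δ * bandConst q Q * (logE δ)⁻¹ := h1
    _ ≤ (2 * s) * bandConst q Q * (2 * (logE s)⁻¹) := by gcongr; linarith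
    _ = _ := by ring

lemma ScaleCondition.measure_band_le {T Ω : Type*} [MetricSpace T] [MeasurableSpace Ω]
    {ν : Measure Ω} {X : T → Ω → ℝ} {σ : T → ℝ} {G : ℝ → ℝ → ℝ} {L A B W α q Q C δ : ℝ}
    (hX : ScaleCondition ν X σ G L) (hG : ∀ η δ, 0 ≤ η → 0 < δ → 0 ≤ G η δ)
    (hdist : ∀ s t : T, dist s t ≤ 1) (hcov : LocalCoveringBound σ A B W α)
    (hA : 0 < A) (hB : 0 < B) (hW : 0 < W) (hα : 0 < α) (hq : 0 < q) (hQ : 0 < Q)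
    (hC : (q + 1) * B + α + 2 ≤ C) (hC4 : 4 * bandConst q Q ≤ C) (hδ : 0 < δ) (hδ1 : δ ≤ 1) :
    ν (modulusEvent X (2 * δ) q Q ∩ {ω | ∃ t, δ / 2 < σ t ∧ σ t ≤ δ ∧
      correction G W C (σ t) + C * (logE (σ t))⁻¹ < |X t ω| / σ t}) ≤
        ENNReal.ofReal (2 * A * (q + 2) ^ α * (logE δ ^ 2)⁻¹) := by
  have hl := one_le_logE hδ hδ1
  have hl0 : 0 < logE δ := by linarith
  have hC0 : 0 ≤ C := by nlinarith
  have hu : 0 < logE δ ^ (-(q + 1)) := Real.rpow_pos_of_pos hl0 _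
  have hu1 : logE δ ^ (-(q + 1)) ≤ 1 := Real.rpow_le_one_of_one_le_of_nonpos hl (by linarith)
  have hr : 0 < logE δ ^ (-(q + 1)) * δ := mul_pos hu hδ
  have hrδ : logE δ ^ (-(q + 1)) * δ ≤ δ := mul_le_of_le_one_left hδ.le hu1
  have hlog1 := one_le_logE hr (hrδ.trans hδ1)
  have hN := hcov _ δ hu hu1 hδ hδ1
  have hN0 : 0 ≤ A * (logE δ ^ (-(q + 1))) ^ (-B) * δ ^ (-W) *
      logE (logE δ ^ (-(q + 1)) * δ) ^ α := by
    have : 0 ≤ logE (logE δ ^ (-(q + 1)) * δ) ^ α := Real.rpow_nonneg (by linarith) α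
    positivity
  have key := hX.measure_cells_le hG hdist (S := {t | σ t ≤ δ})
    (S' := {t | δ / 2 < σ t ∧ σ t ≤ δ}) (fun t ht => ht.2) hr (hrδ.trans hδ1)
    (by linarith : 2 * (logE δ ^ (-(q + 1)) * δ) ≤ 2 * δ) hN0 (div_pos hδ hl0) hq hQ hN
    (fun t => penaltyExponent W C (σ t))
    (fun t => penaltyExponent_nonneg hW.le hC0 (hX.pos t) (hX.le_one t))
    -- The exponent decreases in the scale, so its least value on the band is bounded below by the
    -- one at the upper end `δ`.
    (η₀ := penaltyExponent W C δ)
    (fun t ht => penaltyExponent_anti hW.le hC0 (hX.pos t) ht.2 hδ1)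
  refine (measure_mono ?_).trans (key.trans (ENNReal.ofReal_le_ofReal
    (covering_mul_tail_le hA hα hq hC hδ hδ1)))
  rintro ω ⟨hω, t, ht1, ht2, hlt⟩
  refine ⟨hω, t, ⟨ht1, ht2⟩, ?_⟩
  have hσ := hX.pos t
  have hls := one_le_logE hσ (hX.le_one t)
  have herr := band_error_le hq hQ hδ hδ1 ht1 (hX.le_one t)
  rw [div_le_iff₀ hσ] at herr
  rw [lt_div_iff₀ hσ] at hlt
  have h3 : 4 * bandConst q Q * (logE (σ t))⁻¹ * σ t ≤ C * (logE (σ t))⁻¹ * σ t := by gcongr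
  change σ t * correction G W C (σ t) + _ < _
  linarith

/-! ### Summation over the bands -/

/-- Telescoping: with `a = 2 l - 1 + k`, `log 2 ≥ 1/2` gives `(l + k log 2)^2 ≥ (a + 1)^2 / 4 ≥ a (a
+ 1) / 4`, whose inverse is `4/a - 4/(a + 1)`. The first term suffices because `2 l - 1 ≥ l`. -/
lemma sum_range_inv_sq_le {l : ℝ} (hl : 1 ≤ l) (n : ℕ) :
    ∑ k ∈ Finset.range n, ((l + k * Real.log 2) ^ 2)⁻¹ ≤ 4 * l⁻¹ := by
  have hstep : ∀ k : ℕ, ((l + k * Real.log 2) ^ 2)⁻¹ ≤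
      4 * (2 * l - 1 + k)⁻¹ - 4 * (2 * l - 1 + (k + 1 : ℕ))⁻¹ := by
    intro k
    have hk : (0 : ℝ) ≤ k := Nat.cast_nonneg k
    have h1 : l + k / 2 ≤ l + k * Real.log 2 := by nlinarith [Real.log_two_gt_d9]
    have ha : 0 < 2 * l - 1 + k := by linarith
    calc ((l + k * Real.log 2) ^ 2)⁻¹ ≤ ((l + k / 2) ^ 2)⁻¹ := by gcongr
      _ ≤ ((2 * l - 1 + k) * (2 * l - 1 + k + 1) / 4)⁻¹ := by
          gcongr
          nlinarith
      _ = _ := by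
          push_cast
          rw [← add_assoc]
          generalize 2 * l - 1 + (k : ℝ) = a at ha
          field_simp
          ring
  calc _ ≤ ∑ k ∈ Finset.range n, (4 * (2 * l - 1 + k)⁻¹ - 4 * (2 * l - 1 + (k + 1 : ℕ))⁻¹) :=
        Finset.sum_le_sum fun k _ => hstep k
    _ = 4 * (2 * l - 1 + (0 : ℕ))⁻¹ - 4 * (2 * l - 1 + n)⁻¹ :=
        Finset.sum_range_sub' (fun k : ℕ => 4 * (2 * l - 1 + k)⁻¹) n
    _ ≤ 4 * (2 * l - 1 + (0 : ℕ))⁻¹ := by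
        have : 0 ≤ 4 * (2 * l - 1 + n)⁻¹ := by
          have : 0 ≤ 2 * l - 1 + n := by linarith [(Nat.cast_nonneg n : (0 : ℝ) ≤ n)]
          positivity
        linarith
    _ ≤ 4 * l⁻¹ := by
        gcongr
        push_cast
        linarith

lemma logE_div_two_pow {δ : ℝ} (hδ : 0 < δ) (k : ℕ) :
    logE (δ / 2 ^ k) = logE δ + k * Real.log 2 := by
  rw [logE_eq hδ, logE_eq (by positivity), Real.log_div hδ.ne' (by positivity), Real.log_pow]
  ring

/-- On the modulus event, the bound on small scales fails with small probability. -/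
theorem ScaleCondition.measure_modulusEvent_diff_le {T Ω : Type*} [MetricSpace T]
    [MeasurableSpace Ω] {ν : Measure Ω} {X : T → Ω → ℝ} {σ : T → ℝ} {G : ℝ → ℝ → ℝ}
    {L A B W α q Q δ : ℝ}
    (hX : ScaleCondition ν X σ G L) (hG : ∀ η δ, 0 ≤ η → 0 < δ → 0 ≤ G η δ)
    (hdist : ∀ s t : T, dist s t ≤ 1) (hcov : LocalCoveringBound σ A B W α)
    (hA : 0 < A) (hB : 0 < B) (hW : 0 < W) (hα : 0 < α) (hq : 0 < q) (hQ : 0 < Q)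
    (hδ : 0 < δ) (hδ1 : δ ≤ 1) :
    ν (modulusEvent X (2 * δ) q Q \ smallScaleEvent X σ G W (chainingConst A B α q Q) δ) ≤
      ENNReal.ofReal (chainingConst A B α q Q * (logE δ)⁻¹) := by
  set C := chainingConst A B α q Q with hCdef
  have hl := one_le_logE hδ hδ1
  have hD := one_le_bandConst hq hQ
  have hP : 0 < (q + 2) ^ α := by positivity
  have hAP : 0 < A * (q + 2) ^ α := by positivity
  have hqB : 0 < (q + 1) * B := by positivity
  -- The three summands of the constant serve the union bound, the error in a band, and the summed
  -- probabilities (`8 = 2 * 4`).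
  have hC1 : (q + 1) * B + α + 2 ≤ C := by rw [hCdef, chainingConst]; linarith
  have hC2 : 4 * bandConst q Q ≤ C := by rw [hCdef, chainingConst]; linarith
  have hC3 : 8 * A * (q + 2) ^ α ≤ C := by rw [hCdef, chainingConst]; linarith
  have hband : ∀ k : ℕ, ν (modulusEvent X (2 * (δ / 2 ^ k)) q Q ∩
      {ω | ∃ t, δ / 2 ^ k / 2 < σ t ∧ σ t ≤ δ / 2 ^ k ∧
      correction G W C (σ t) + C * (logE (σ t))⁻¹ < |X t ω| / σ t}) ≤
        ENNReal.ofReal (2 * A * (q + 2) ^ α * ((logE δ + k * Real.log 2) ^ 2)⁻¹) := by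
    intro k
    rw [← logE_div_two_pow hδ k]
    refine hX.measure_band_le hG hdist hcov hA hB hW hα hq hQ hC1 hC2 (by positivity) ?_
    exact (div_le_self hδ.le (one_le_pow₀ one_le_two)).trans hδ1
  have hsub : modulusEvent X (2 * δ) q Q \ smallScaleEvent X σ G W C δ ⊆
      ⋃ k : ℕ, (modulusEvent X (2 * (δ / 2 ^ k)) q Q ∩
      {ω | ∃ t, δ / 2 ^ k / 2 < σ t ∧ σ t ≤ δ / 2 ^ k ∧
      correction G W C (σ t) + C * (logE (σ t))⁻¹ < |X t ω| / σ t}) := by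
    rintro ω ⟨hω, hns⟩
    have hns' : ∃ t, σ t ≤ δ ∧
        correction G W C (σ t) + C * (logE (σ t))⁻¹ < |X t ω| / σ t := by
      by_contra hcon
      push Not at hcon
      exact hns hcon
    obtain ⟨t, ht, hlt⟩ := hns'
    -- The band of `t` is the `k` with `2^(-(k+1)) < σ t / δ ≤ 2^(-k)`.
    obtain ⟨k, hk1, hk2⟩ := exists_nat_pow_near_of_lt_one (div_pos (hX.pos t) hδ)
      ((div_le_one hδ).2 ht) (by norm_num : (0 : ℝ) < 1 / 2) (by norm_num)
    rw [lt_div_iff₀ hδ] at hk1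
    rw [div_le_iff₀ hδ] at hk2
    refine Set.mem_iUnion.2 ⟨k, modulusEvent_anti X q Q ?_ hω, t, ?_, ?_, hlt⟩
    · have := div_le_self hδ.le (one_le_pow₀ (one_le_two : (1 : ℝ) ≤ 2) (n := k))
      linarith
    · refine lt_of_eq_of_lt ?_ hk1
      rw [pow_succ, div_pow, one_pow]
      ring
    · refine hk2.trans_eq ?_
      rw [div_pow, one_pow]
      ring
  refine (measure_mono hsub).trans ((measure_iUnion_le _).trans
    ((ENNReal.tsum_le_tsum hband).trans ?_))
  refine ENNReal.tsum_le_of_sum_range_le fun n => ?_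
  rw [← ENNReal.ofReal_sum_of_nonneg (fun k _ => by positivity), ← Finset.mul_sum]
  apply ENNReal.ofReal_le_ofReal
  calc _ ≤ 2 * A * (q + 2) ^ α * (4 * (logE δ)⁻¹) := by
        gcongr
        exact sum_range_inv_sq_le hl n
    _ = 8 * A * (q + 2) ^ α * (logE δ)⁻¹ := by ring
    _ ≤ _ := by gcongr

theorem ScaleCondition.measureReal_smallScaleEvent_ge {T Ω : Type*} [MetricSpace T]
    [MeasurableSpace Ω] {ν : Measure Ω} [IsFiniteMeasure ν] {X : T → Ω → ℝ} {σ : T → ℝ}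
    {G : ℝ → ℝ → ℝ} {L A B W α q Q δ : ℝ}
    (hX : ScaleCondition ν X σ G L) (hG : ∀ η δ, 0 ≤ η → 0 < δ → 0 ≤ G η δ)
    (hdist : ∀ s t : T, dist s t ≤ 1) (hcov : LocalCoveringBound σ A B W α)
    (hA : 0 < A) (hB : 0 < B) (hW : 0 < W) (hα : 0 < α) (hq : 0 < q) (hQ : 0 < Q)
    (hC : 0 < chainingConst A B α q Q) (hδ : 0 < δ) (hδ1 : δ ≤ 1) :
    ν.real (modulusEvent X (2 * δ) q Q) - chainingConst A B α q Q * (logE δ)⁻¹ ≤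
      ν.real (smallScaleEvent X σ G W (chainingConst A B α q Q) δ) := by
  have hl := one_le_logE hδ hδ1
  have h := ENNReal.toReal_mono ENNReal.ofReal_ne_top
    (hX.measure_modulusEvent_diff_le hG hdist hcov hA hB hW hα hq hQ hδ hδ1)
  rw [ENNReal.toReal_ofReal (by positivity)] at h
  have h2 : ν.real (modulusEvent X (2 * δ) q Q) ≤
      ν.real (smallScaleEvent X σ G W (chainingConst A B α q Q) δ) +
      ν.real (modulusEvent X (2 * δ) q Q \
        smallScaleEvent X σ G W (chainingConst A B α q Q) δ) := by
    refine (measureReal_mono ?_).trans (measureReal_union_le _ _)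
    rw [Set.union_sdiff_self]
    exact Set.subset_union_right
  change ν.real _ ≤ _ at h
  linarith

lemma chainingConst_pos {A B α q Q : ℝ} (hA : 0 < A) (hB : 0 < B) (hα : 0 < α) (hq : 0 < q)
    (hQ : 0 < Q) : 0 < chainingConst A B α q Q := by
  have := one_le_bandConst hq hQ
  rw [chainingConst]
  positivity

/-! ### Large scales and the penalised supremum -/

/-- Bound for the standardised process on the scales `σ ≥ δ`. -/
noncomputable def largeScaleBound (Go q Q δ η : ℝ) : ℝ :=
  Go * (1 + η) + (1 + Q * (2 * (1 + q) ^ q * δ * logE δ ^ q)) / δ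

lemma ScaleCondition.measure_large_scale_le {T Ω : Type*} [MetricSpace T] [MeasurableSpace Ω]
    {ν : Measure Ω} {X : T → Ω → ℝ} {σ : T → ℝ} {G : ℝ → ℝ → ℝ} {Go L A B W α q Q δ η : ℝ}
    (hX : ScaleCondition ν X σ G L) (hG : ∀ η δ, 0 ≤ η → 0 < δ → 0 ≤ G η δ)
    (hGo : ∀ η δ, 0 ≤ η → 0 < δ → δ ≤ 1 → G η δ ≤ Go * (1 + η))
    (hdist : ∀ s t : T, dist s t ≤ 1) (hcov : LocalCoveringBound σ A B W α)
    (hA : 0 < A) (hq : 0 < q) (hQ : 0 < Q) (hδ : 0 < δ) (hδ1 : δ ≤ 1) (hη : 0 ≤ η) :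
    ν (modulusEvent X (2 * δ) q Q ∩
      {ω | ∃ t, δ < σ t ∧ largeScaleBound Go q Q δ η < |X t ω| / σ t}) ≤
        ENNReal.ofReal (A * δ ^ (-B) * logE δ ^ α * (2 * Real.exp (-η))) := by
  have hl := one_le_logE hδ hδ1
  -- With `u = δ` at scale `1` this covers the whole index space at radius `δ`, matching the modulus
  -- event at `2 δ`.
  have hN := hcov δ 1 hδ hδ1 one_pos le_rfl
  rw [mul_one, Real.one_rpow, mul_one] at hN
  have hlα : 0 ≤ logE δ ^ α := Real.rpow_nonneg (by linarith) α
  have hlq : 0 ≤ logE δ ^ q := Real.rpow_nonneg (by linarith) q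
  refine (measure_mono ?_).trans (hX.measure_cells_le hG hdist (S := {t | σ t ≤ 1})
    (S' := {t | δ < σ t}) (fun t _ => hX.le_one t) hδ hδ1 le_rfl (by positivity) one_pos hq hQ hN
    (fun _ => η) (fun _ => hη) (fun _ _ => le_rfl))
  rintro ω ⟨hω, t, ht, hlt⟩
  refine ⟨hω, t, ht, ?_⟩
  have hσ := hX.pos t
  rw [lt_div_iff₀ hσ, largeScaleBound, add_mul] at hlt
  have h1 : σ t * G η (σ t) ≤ Go * (1 + η) * σ t := by
    rw [mul_comm (σ t)]
    exact mul_le_mul_of_nonneg_right (hGo η (σ t) hη hσ (hX.le_one t)) hσ.le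
  have h2 : 1 + Q * (2 * (1 + q) ^ q * δ * logE δ ^ q) ≤
      (1 + Q * (2 * (1 + q) ^ q * δ * logE δ ^ q)) / δ * σ t := by
    rw [div_mul_eq_mul_div, le_div_iff₀ hδ]
    exact mul_le_mul_of_nonneg_left (le_of_lt ht) (by positivity)
  linarith

lemma measurableSet_modulusEvent {T Ω : Type*} [MetricSpace T] [Countable T] [MeasurableSpace Ω]
    {X : T → Ω → ℝ} (hX : ∀ t, Measurable (X t)) (δ q Q : ℝ) :
    MeasurableSet (modulusEvent X δ q Q) := by
  simp only [modulusEvent, Set.ofPred_forall]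
  refine MeasurableSet.iInter fun s => MeasurableSet.iInter fun t => MeasurableSet.iInter fun _ =>
    MeasurableSet.iInter fun _ => measurableSet_le ?_ measurable_const
  have h1 := hX s
  have h2 := hX t
  exact (measurable_norm.comp (h1.sub h2)).div_const _

lemma measurable_penalizedSup {T Ω : Type*} [Countable T] [MeasurableSpace Ω]
    {X : T → Ω → ℝ} (hX : ∀ t, Measurable (X t)) (σ : T → ℝ) (G : ℝ → ℝ → ℝ) (W C : ℝ) :
    Measurable (penalizedSup X σ G W C) := by
  refine Measurable.iSup fun t => measurable_coe_real_ereal.comp ?_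
  exact ((measurable_norm.comp (hX t)).div_const _).sub_const _

lemma mem_image_coe_Icc {x : EReal} {M : ℝ} (h1 : ((-M : ℝ) : EReal) ≤ x) (h2 : x ≤ (M : EReal)) :
    x ∈ ((↑) : ℝ → EReal) '' Set.Icc (-M) M := by
  induction x with
  | bot => simp at h1
  | top => simp at h2
  | coe r => exact ⟨r, ⟨EReal.coe_le_coe_iff.1 h1, EReal.coe_le_coe_iff.1 h2⟩, rfl⟩

/-- The three terms are the ways to fail: no modulus bound, a large value at small scales, a large
value at large scales. Otherwise the supremum is bounded above, and one point with `σ t > s` bounds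
it below by minus its correction. -/
lemma ScaleCondition.measure_penalizedSup_le {T Ω : Type*} [MetricSpace T] [MeasurableSpace Ω]
    {ν : Measure Ω} {X : T → Ω → ℝ} {σ : T → ℝ} {G : ℝ → ℝ → ℝ}
    {Go L A B W α q Q δ η s M : ℝ}
    (hX : ScaleCondition ν X σ G L) (hG : ∀ η δ, 0 ≤ η → 0 < δ → 0 ≤ G η δ)
    (hGo : ∀ η δ, 0 ≤ η → 0 < δ → δ ≤ 1 → G η δ ≤ Go * (1 + η))
    (hdist : ∀ s t : T, dist s t ≤ 1) (hcov : LocalCoveringBound σ A B W α)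
    (hA : 0 < A) (hB : 0 < B) (hW : 0 < W) (hα : 0 < α) (hq : 0 < q) (hQ : 0 < Q)
    (hδ : 0 < δ) (hδ1 : δ ≤ 1) (hη : 0 ≤ η) (hs : 0 < s) (hsup : s < ⨆ t, σ t)
    (hM1 : largeScaleBound Go q Q δ η ≤ M) (hM2 : chainingConst A B α q Q ≤ M)
    (hM3 : Go * (1 + penaltyExponent W (chainingConst A B α q Q) s) ≤ M) :
    ν {ω | penalizedSup X σ G W (chainingConst A B α q Q) ω ∉
      ((↑) : ℝ → EReal) '' Set.Icc (-M) M} ≤ ν (modulusEvent X (2 * δ) q Q)ᶜ +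
        ENNReal.ofReal (chainingConst A B α q Q * (logE δ)⁻¹) +
        ENNReal.ofReal (A * δ ^ (-B) * logE δ ^ α * (2 * Real.exp (-η))) := by
  have hC := chainingConst_pos hA hB hα hq hQ
  refine le_trans (measure_mono ?_) ((measure_union_le _ _).trans (add_le_add
    ((measure_union_le _ _).trans (add_le_add le_rfl
      (hX.measure_modulusEvent_diff_le hG hdist hcov hA hB hW hα hq hQ hδ hδ1)))
    (hX.measure_large_scale_le hG hGo hdist hcov hA hq hQ hδ hδ1 hη)))
  intro ω hω
  by_contra hcon
  simp only [Set.mem_union, not_or] at hcon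
  obtain ⟨⟨hm, hsm⟩, hlg⟩ := hcon
  have hm : ω ∈ modulusEvent X (2 * δ) q Q := not_not.1 hm
  have hsm : ω ∈ smallScaleEvent X σ G W (chainingConst A B α q Q) δ := by
    by_contra h
    exact hsm ⟨hm, h⟩
  have hcorr : ∀ t, 0 ≤ correction G W (chainingConst A B α q Q) (σ t) := fun t =>
    hG _ _ (penaltyExponent_nonneg hW.le hC.le (hX.pos t) (hX.le_one t)) (hX.pos t)
  refine hω (mem_image_coe_Icc ?_ (iSup_le fun t => EReal.coe_le_coe_iff.2 ?_))
  -- An empty supremum of reals is `0`, contradicting `0 < s < ⨆ t, σ t`.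
  · have : Nonempty T := by
      by_contra h
      rw [not_nonempty_iff] at h
      rw [Real.iSup_of_isEmpty] at hsup
      linarith
    obtain ⟨t, ht⟩ := exists_lt_of_lt_ciSup hsup
    refine le_trans (EReal.coe_le_coe_iff.2 ?_) (le_iSup (fun t => ((|X t ω| / σ t -
      correction G W (chainingConst A B α q Q) (σ t) : ℝ) : EReal)) t)
    have hσ := hX.pos t
    have h0 := penaltyExponent_nonneg hW.le hC.le hσ (hX.le_one t)
    have h1 : correction G W (chainingConst A B α q Q) (σ t) ≤ _ :=
      hGo _ _ h0 hσ (hX.le_one t)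
    have h2 := penaltyExponent_anti hW.le hC.le hs ht.le (hX.le_one t)
    have hGo0 : 0 ≤ Go := by
      have := (hG 0 1 le_rfl one_pos).trans (hGo 0 1 le_rfl one_pos le_rfl)
      simpa using this
    have h3 := mul_le_mul_of_nonneg_left h2 hGo0
    have h4 : 0 ≤ |X t ω| / σ t := div_nonneg (abs_nonneg _) hσ.le
    change _ ≤ Go * (1 + penaltyExponent W (chainingConst A B α q Q) (σ t)) at h1
    linarith
  · rcases le_or_gt (σ t) δ with ht | ht
    · have h1 := hsm t ht
      have h2 : chainingConst A B α q Q * (logE (σ t))⁻¹ ≤ chainingConst A B α q Q :=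
        mul_le_of_le_one_right hC.le (inv_le_one_of_one_le₀ (one_le_logE (hX.pos t) (hX.le_one t)))
      linarith
    · have h1 : |X t ω| / σ t ≤ largeScaleBound Go q Q δ η := by
        by_contra h
        exact hlg ⟨hm, t, ht, not_le.1 h⟩
      linarith [hcorr t]

/-! ### Measurability and almost sure limits -/

/-- The conditional probability of a section `D (Y ω)` is almost everywhere measurable if the set
of `ω` with `ω ∈ D (Y ω)` is measurable up to a null set. -/
lemma aemeasurable_condKernel_section {Ω 𝒴 : Type*} [MeasurableSpace Ω] {μ : Measure Ω}
    [IsProbabilityMeasure μ] [TopologicalSpace 𝒴] [PolishSpace 𝒴] [MeasurableSpace 𝒴]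
    [BorelSpace 𝒴] {Y : Ω → 𝒴} (hY : Measurable Y) {κ : Kernel 𝒴 Ω} [IsMarkovKernel κ]
    (hκ : (μ.map (fun ω => (Y ω, ω))).IsCondKernel κ) {D : 𝒴 → Set Ω}
    (hD : NullMeasurableSet {ω | ω ∈ D (Y ω)} μ) :
    AEMeasurable (fun ω => κ (Y ω) (D (Y ω))) μ := by
  obtain ⟨E, hE, hDE⟩ := hD
  have hYid : Measurable fun ω => (Y ω, ω) := hY.prodMk measurable_id
  have hfst : (μ.map (fun ω => (Y ω, ω))).fst = μ.map Y := by
    rw [Measure.fst, Measure.map_map measurable_fst hYid]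
    rfl
  have hsnd : (μ.map (fun ω => (Y ω, ω))).map Prod.snd = μ := by
    rw [Measure.map_map measurable_snd hYid]
    exact Measure.map_id
  have hgraph : ∀ᵐ z ∂μ.map (fun ω => (Y ω, ω)), Y z.2 = z.1 := by
    have hm : MeasurableSet {z : 𝒴 × Ω | Y z.2 = z.1} :=
      measurableSet_eq_fun (hY.comp measurable_snd) measurable_fst
    exact (ae_map_iff hYid.aemeasurable hm).2 (Eventually.of_forall fun _ => rfl)
  have hsec : ∀ᵐ z ∂μ.map (fun ω => (Y ω, ω)), (z.2 ∈ D (Y z.2) ↔ z.2 ∈ E) := by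
    refine ae_of_ae_map (f := Prod.snd) (p := fun ω => ω ∈ D (Y ω) ↔ ω ∈ E)
      measurable_snd.aemeasurable ?_
    rw [hsnd]
    filter_upwards [hDE] with ω h using iff_of_eq h
  have hboth := hgraph.and hsec
  -- The joint law lives on the graph of `Y`. Disintegrating it shows that for almost every `y` the
  -- sets `D y` and `E` agree up to a `κ y`-null set.
  rw [← Measure.disintegrate (μ.map (fun ω => (Y ω, ω))) κ, hfst] at hboth
  have hae := ae_of_ae_map hY.aemeasurable (Measure.ae_ae_of_ae_compProd hboth)
  refine ⟨fun ω => κ (Y ω) E, (κ.measurable_coe hE).comp hY, ?_⟩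
  filter_upwards [hae] with ω h
  refine measure_congr ?_
  filter_upwards [h] with ω' h'
  refine propext ?_
  have h2 : ω' ∈ D (Y ω') ↔ ω' ∈ E := h'.2
  have h1 : Y ω' = Y ω := h'.1
  rw [h1] at h2
  exact h2

lemma eventually_measure_compl_le {Ω : Type*} [MeasurableSpace Ω] {μ : Measure Ω}
    [IsProbabilityMeasure μ] {S : ℕ → Set Ω} (hS : ∀ j, NullMeasurableSet (S j) μ)
    (hmono : Monotone S) (hae : ∀ᵐ ω ∂μ, ∃ j, ω ∈ S j) {η : ℝ≥0∞} (hη : 0 < η) :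
    ∀ᶠ j in atTop, μ (S j)ᶜ ≤ η := by
  have h := tendsto_measure_iInter_atTop (μ := μ) (fun j => (hS j).compl)
    (fun i j hij => Set.compl_subset_compl.2 (hmono hij)) ⟨0, measure_ne_top _ _⟩
  have h0 : μ (⋂ j, (S j)ᶜ) = 0 := by
    rw [← Set.compl_iUnion]
    have : ∀ᵐ ω ∂μ, ω ∈ ⋃ j, S j := by simpa using hae
    exact this
  rw [h0] at h
  exact h.eventually_le_const hη

lemma tendsto_logE_inv_nat : Tendsto (fun j : ℕ => logE (1 / ((j : ℝ) + 1))) atTop atTop := by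
  have h : (fun j : ℕ => logE (1 / ((j : ℝ) + 1))) = fun j : ℕ => 1 + Real.log ((j : ℝ) + 1) := by
    funext j
    rw [logE_eq (by positivity), one_div, Real.log_inv]
    ring
  rw [h]
  exact tendsto_atTop_add_const_left _ _ (Real.tendsto_log_atTop.comp
    (tendsto_atTop_add_const_right _ _ tendsto_natCast_atTop_atTop))

/-! ### Tightness in probability -/

theorem tightInProbability_penalizedSup
    {Go A B W α q Q : ℝ} (hA : 0 < A) (hB : 0 < B) (hW : 0 < W) (hα : 0 < α)
    (hq : 0 < q) (hQ : 0 < Q) {Ω : Type*} [MeasurableSpace Ω] {μ : Measure Ω}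
    [IsProbabilityMeasure μ] {𝒴 : ℕ → Type*} [∀ n, TopologicalSpace (𝒴 n)]
    [∀ n, PolishSpace (𝒴 n)] [∀ n, MeasurableSpace (𝒴 n)] [∀ n, BorelSpace (𝒴 n)]
    {Y : ∀ n, Ω → 𝒴 n} (hY : ∀ n, Measurable (Y n)) {κ : ∀ n, Kernel (𝒴 n) Ω}
    [∀ n, IsMarkovKernel (κ n)]
    (hκ : ∀ n, (μ.map (fun ω => (Y n ω, ω))).IsCondKernel (κ n))
    {T : ∀ n, 𝒴 n → Type*} [∀ n y, Countable (T n y)] [∀ n y, MetricSpace (T n y)]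
    (hdist : ∀ n y (s t : T n y), dist s t ≤ 1)
    {Z : ∀ n (y : 𝒴 n), T n y → Ω → ℝ} (hZ : ∀ n y t, Measurable (Z n y t))
    {σ : ∀ n (y : 𝒴 n), T n y → ℝ} {G : ℕ → ℝ → ℝ → ℝ} {L : ℝ}
    (hG : ∀ n η δ, 0 ≤ η → 0 < δ → 0 ≤ G n η δ)
    (hGo : ∀ n η δ, 0 ≤ η → 0 < δ → δ ≤ 1 → G n η δ ≤ Go * (1 + η))
    (hscale : ∀ n, ∀ᵐ y ∂(μ.map (Y n)), ScaleCondition (κ n y) (Z n y) (σ n y) (G n) L)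
    {𝒞 : ∀ n, Set (𝒴 n)} (h𝒞 : ∀ n, MeasurableSet (𝒞 n))
    (hcov : ∀ n, ∀ᵐ y ∂(μ.map (Y n)), y ∈ 𝒞 n → LocalCoveringBound (σ n y) A B W α)
    (hmod : ∀ n δ, 0 < δ → NullMeasurableSet {ω | ω ∈ modulusEvent (Z n (Y n ω)) δ q Q} μ)
    (hsup : ∀ n, AEMeasurable (fun ω => ⨆ t, σ n (Y n ω) t) μ)
    (h𝒞lim : Tendsto (fun n => μ.map (Y n) (𝒞 n)) atTop (𝓝 1))
    (hmodlim : ∀ᵐ ω ∂μ, Tendsto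
      (fun δ : ℝ => ⨅ n, κ n (Y n ω) (modulusEvent (Z n (Y n ω)) δ q Q)) (𝓝[>] 0) (𝓝 1))
    (hinf : ∀ᵐ ω ∂μ, 0 < ⨅ n, ⨆ t, σ n (Y n ω) t) :
    TightInProbability μ (fun n ω => (κ n (Y n ω)).map
      (penalizedSup (Z n (Y n ω)) (σ n (Y n ω)) (G n) W (chainingConst A B α q Q))) := by
  intro ε η hε hη
  set C := chainingConst A B α q Q with hCdef
  have hη2 : 0 < η / 2 := ENNReal.half_pos hη.ne'
  -- One share of `ε` for each of the three failure terms; the minimum with `1` handles `ε = ⊤`.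
  obtain ⟨e, he, heε⟩ : ∃ e : ℝ, 0 < e ∧ ENNReal.ofReal e + ENNReal.ofReal e +
      ENNReal.ofReal e ≤ ε := by
    have hm : min ε 1 ≠ ⊤ := ((min_le_right ε 1).trans_lt ENNReal.one_lt_top).ne
    have hm0 : 0 < (min ε 1).toReal := ENNReal.toReal_pos (lt_min hε one_pos).ne' hm
    refine ⟨(min ε 1).toReal / 3, by positivity, ?_⟩
    rw [← ENNReal.ofReal_add (by positivity) (by positivity),
      ← ENNReal.ofReal_add (by positivity) (by positivity),
      show (min ε 1).toReal / 3 + (min ε 1).toReal / 3 + (min ε 1).toReal / 3 =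
        (min ε 1).toReal by ring, ENNReal.ofReal_toReal hm]
    exact min_le_left _ _
  -- a lower bound for the largest scale, uniformly in `n`
  obtain ⟨i, hi⟩ := (eventually_measure_compl_le (μ := μ)
    (S := fun i : ℕ => {ω | 1 / ((i : ℝ) + 1) < ⨅ n, ⨆ t, σ n (Y n ω) t})
    (fun i => nullMeasurableSet_lt aemeasurable_const (AEMeasurable.iInf hsup))
    (fun i j hij => Set.ofPred_subset_ofPred.2 fun ω hω =>
      (Nat.one_div_le_one_div hij).trans_lt hω)
    (hinf.mono fun ω h => exists_nat_one_div_lt h) hη2).exists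
  -- a scale on which the modulus event is likely, uniformly in `n`
  have hmodS : ∀ᶠ j : ℕ in atTop, μ {ω | 1 - ENNReal.ofReal e < ⨅ n, κ n (Y n ω)
      (modulusEvent (Z n (Y n ω)) (2 * (1 / ((j : ℝ) + 1))) q Q)}ᶜ ≤ η / 2 := by
    refine eventually_measure_compl_le (μ := μ) (fun j => nullMeasurableSet_lt aemeasurable_const
      (AEMeasurable.iInf fun n => aemeasurable_condKernel_section (hY n) (hκ n)
        (D := fun y => modulusEvent (Z n y) (2 * (1 / ((j : ℝ) + 1))) q Q)
        (hmod n _ (by positivity)))) ?_ ?_ hη2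
    · intro j k hjk ω hω
      refine lt_of_lt_of_le hω (iInf_mono fun n => measure_mono (modulusEvent_anti _ q Q ?_))
      exact mul_le_mul_of_nonneg_left (Nat.one_div_le_one_div hjk) zero_le_two
    · filter_upwards [hmodlim] with ω h
      have hseq : Tendsto (fun j : ℕ => 2 * (1 / ((j : ℝ) + 1))) atTop (𝓝[>] 0) := by
        refine tendsto_nhdsWithin_iff.2 ⟨?_, Eventually.of_forall fun j => ?_⟩
        · simpa using tendsto_one_div_add_atTop_nhds_zero_nat.const_mul (2 : ℝ)
        · exact Set.mem_Ioi.2 (by positivity)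
      have hlt : 1 - ENNReal.ofReal e < 1 :=
        ENNReal.sub_lt_self ENNReal.one_ne_top one_ne_zero (ENNReal.ofReal_pos.2 he).ne'
      exact ((h.comp hseq).eventually_const_lt hlt).exists
  have hlog : ∀ᶠ j : ℕ in atTop, C * (logE (1 / ((j : ℝ) + 1)))⁻¹ ≤ e := by
    have h := (tendsto_inv_atTop_zero.comp tendsto_logE_inv_nat).const_mul C
    rw [mul_zero] at h
    exact h.eventually_le_const he
  obtain ⟨j, hj, hjlog⟩ := (hmodS.and hlog).exists
  set δ : ℝ := 1 / ((j : ℝ) + 1) with hδdef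
  have hδ : 0 < δ := by positivity
  have hδ1 : δ ≤ 1 := by
    rw [hδdef, div_le_one (by positivity)]
    linarith [(Nat.cast_nonneg j : (0 : ℝ) ≤ j)]
  obtain ⟨ζ, hζ0, hζ⟩ : ∃ ζ : ℝ, 0 ≤ ζ ∧
      A * δ ^ (-B) * logE δ ^ α * (2 * Real.exp (-ζ)) ≤ e := by
    have h := ((Real.tendsto_exp_neg_atTop_nhds_zero).const_mul 2).const_mul
      (A * δ ^ (-B) * logE δ ^ α)
    rw [mul_zero, mul_zero] at h
    exact ((eventually_ge_atTop 0).and (h.eventually_le_const he)).exists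
  set s : ℝ := 1 / ((i : ℝ) + 1) with hsdef
  have hs : 0 < s := by positivity
  set M : ℝ := max (largeScaleBound Go q Q δ ζ) (max C (Go * (1 + penaltyExponent W C s)))
  refine ⟨Set.Icc (-M) M, isCompact_Icc, ?_⟩
  have hK : MeasurableSet (((↑) : ℝ → EReal) '' Set.Icc (-M) M) :=
    (isCompact_Icc.image continuous_coe_real_ereal).isClosed.measurableSet
  have hbound : ∀ n, μ {ω | ε < (κ n (Y n ω)).map
      (penalizedSup (Z n (Y n ω)) (σ n (Y n ω)) (G n) W C)
      (((↑) : ℝ → EReal) '' Set.Icc (-M) M)ᶜ} ≤ η / 2 + η / 2 + (1 - μ.map (Y n) (𝒞 n)) := by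
    intro n
    have hcompl : μ (Y n ⁻¹' 𝒞 n)ᶜ = 1 - μ.map (Y n) (𝒞 n) := by
      rw [prob_compl_eq_one_sub (hY n (h𝒞 n)), Measure.map_apply (hY n) (h𝒞 n)]
    rw [← hcompl]
    -- Almost surely, excess mass requires a small largest scale, an unlikely modulus event, or `Y n
    -- ω ∉ 𝒞 n`.
    refine le_trans (measure_mono_ae ?_) ((measure_union_le _ _).trans (add_le_add
      ((measure_union_le _ _).trans (add_le_add hi hj)) le_rfl))
    filter_upwards [ae_of_ae_map (hY n).aemeasurable (hscale n),
      ae_of_ae_map (hY n).aemeasurable (hcov n), hinf] with ω hX hc hpos hω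
    by_contra hcon
    have hcon' := not_or.1 hcon
    have hcon'' := not_or.1 hcon'.1
    have hyC : Y n ω ∈ 𝒞 n := not_not.1 hcon'.2
    have hsinf : s < ⨅ n, ⨆ t, σ n (Y n ω) t := not_not.1 hcon''.1
    have hminf : 1 - ENNReal.ofReal e < ⨅ n, κ n (Y n ω)
      (modulusEvent (Z n (Y n ω)) (2 * δ) q Q) := not_not.1 hcon''.2
    -- A real infimum that is unbounded below has default value `0`, which positivity excludes.
    have hbdd : BddBelow (Set.range fun n => ⨆ t, σ n (Y n ω) t) := by
      by_contra h
      rw [iInf, Real.sInf_of_not_bddBelow h] at hpos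
      exact lt_irrefl _ hpos
    have hmn : κ n (Y n ω) (modulusEvent (Z n (Y n ω)) (2 * δ) q Q)ᶜ ≤ ENNReal.ofReal e := by
      rw [prob_compl_eq_one_sub (measurableSet_modulusEvent (hZ n (Y n ω)) _ q Q),
        tsub_le_iff_left]
      exact tsub_le_iff_right.1 (hminf.le.trans (iInf_le _ n))
    have hmain := hX.measure_penalizedSup_le (hG n) (hGo n) (hdist n (Y n ω)) (hc hyC)
      hA hB hW hα hq hQ hδ hδ1 hζ0 hs (hsinf.trans_le (ciInf_le hbdd n))
      (le_max_left _ _ : _ ≤ M) ((le_max_left _ _).trans (le_max_right _ _))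
      ((le_max_right _ _).trans (le_max_right _ _))
    have hω' : ε < _ := hω
    rw [Measure.map_apply (measurable_penalizedSup (hZ n (Y n ω)) _ _ _ _) hK.compl] at hω'
    refine absurd hω' (not_lt.2 ?_)
    refine le_trans (hmain.trans ?_) heε
    gcongr
  have hlim : Tendsto (fun n => η / 2 + η / 2 + (1 - μ.map (Y n) (𝒞 n))) atTop (𝓝 η) := by
    have h := (ENNReal.Tendsto.sub (tendsto_const_nhds (x := (1 : ℝ≥0∞))) h𝒞lim
      (Or.inl ENNReal.one_ne_top)).const_add (η / 2 + η / 2)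
    simpa [ENNReal.add_halves] using h
  exact (limsup_le_limsup (Eventually.of_forall hbound)).trans hlim.limsup_eq.le

theorem mainTheorem8
    (Go A B W α q Q : ℝ) (hA : 0 < A) (hB : 0 < B) (hW : 0 < W) (hα : 0 < α)
    (hq : 0 < q) (hQ : 0 < Q) :
    ∃ C : ℝ, 0 < C ∧
      ∀ (Ω : Type*) [MeasurableSpace Ω] (μ : Measure Ω) [IsProbabilityMeasure μ]
        -- the conditioning variables
        (𝒴 : ℕ → Type*) [∀ n, TopologicalSpace (𝒴 n)] [∀ n, PolishSpace (𝒴 n)]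
        [∀ n, MeasurableSpace (𝒴 n)] [∀ n, BorelSpace (𝒴 n)]
        (Y : ∀ n, Ω → 𝒴 n) (_ : ∀ n, Measurable (Y n))
        -- `κ n y` is the regular conditional probability given `Y n = y`
        (κ : ∀ n, Kernel (𝒴 n) Ω) [∀ n, IsMarkovKernel (κ n)]
        (_ : ∀ n, (μ.map (fun ω => (Y n ω, ω))).IsCondKernel (κ n))
        -- the index spaces and the processes
        (T : ∀ n, 𝒴 n → Type*) [∀ n y, Countable (T n y)] [∀ n y, MetricSpace (T n y)]
        (_ : ∀ n y (s t : T n y), dist s t ≤ 1)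
        (Z : ∀ n (y : 𝒴 n), T n y → Ω → ℝ) (_ : ∀ n y t, Measurable (Z n y t))
        (σ : ∀ n (y : 𝒴 n), T n y → ℝ)
        (G : ℕ → ℝ → ℝ → ℝ) (L : ℝ)
        (_ : ∀ n δ, 0 < δ → Measurable (fun η : Set.Ici (0 : ℝ) => G n η δ))
        (_ : ∀ n η δ, 0 ≤ η → 0 < δ → 0 ≤ G n η δ)
        (_ : ∀ n η δ, 0 ≤ η → 0 < δ → δ ≤ 1 → G n η δ / (1 + η) ≤ Go)
        (_ : ∀ n, ∀ᵐ y ∂(μ.map (Y n)), ScaleCondition (κ n y) (Z n y) (σ n y) (G n) L)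
        (𝒞 : ∀ n, Set (𝒴 n)) (_ : ∀ n, MeasurableSet (𝒞 n))
        (_ : ∀ n, ∀ᵐ y ∂(μ.map (Y n)), y ∈ 𝒞 n → LocalCoveringBound (σ n y) A B W α),
        -- first part: the conditional bound on small scales
        (∀ n, ∀ᵐ y ∂(μ.map (Y n)), y ∈ 𝒞 n → ∀ δ : ℝ, 0 < δ → δ ≤ 1 →
          (κ n y).real (modulusEvent (Z n y) (2 * δ) q Q) - C * (logE δ)⁻¹ ≤
            (κ n y).real (smallScaleEvent (Z n y) (σ n y) (G n) W C δ)) ∧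
        -- second part: tightness in probability of the conditional laws
        ((∀ n δ, 0 < δ → NullMeasurableSet {ω | ω ∈ modulusEvent (Z n (Y n ω)) δ q Q} μ) →
          (∀ n, AEMeasurable (fun ω => ⨆ t, σ n (Y n ω) t) μ) →
          Tendsto (fun n => μ.map (Y n) (𝒞 n)) atTop (𝓝 1) →
          (∀ᵐ ω ∂μ, Tendsto
            (fun δ : ℝ => ⨅ n, κ n (Y n ω) (modulusEvent (Z n (Y n ω)) δ q Q))
            (𝓝[>] 0) (𝓝 1)) →
          (∀ᵐ ω ∂μ, 0 < ⨅ n, ⨆ t, σ n (Y n ω) t) →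
          TightInProbability μ (fun n ω =>
            (κ n (Y n ω)).map (penalizedSup (Z n (Y n ω)) (σ n (Y n ω)) (G n) W C))) := by
  refine ⟨chainingConst A B α q Q, chainingConst_pos hA hB hα hq hQ, ?_⟩
  intro Ω _ μ _ 𝒴 _ _ _ _ Y hY κ _ hκ T _ _ hdist Z hZ σ G L _ hG hGo hscale 𝒞 h𝒞 hcov
  have hGo' : ∀ n η δ, 0 ≤ η → 0 < δ → δ ≤ 1 → G n η δ ≤ Go * (1 + η) :=
    fun n η δ hη hδ hδ1 => (div_le_iff₀ (by linarith)).1 (hGo n η δ hη hδ hδ1)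
  refine ⟨fun n => ?_, fun hmod hsup h𝒞lim hmodlim hinf =>
    tightInProbability_penalizedSup hA hB hW hα hq hQ hY hκ hdist hZ hG hGo' hscale h𝒞 hcov
      hmod hsup h𝒞lim hmodlim hinf⟩
  filter_upwards [hscale n, hcov n] with y hX hc hy δ hδ hδ1
  exact hX.measureReal_smallScaleEvent_ge (hG n) (hdist n y) (hc hy) hA hB hW hα hq hQ
    (chainingConst_pos hA hB hα hq hQ) hδ hδ1
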